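/- Theorem. Let $\mathbb{F}_q$ be a finite field with $q$ elements and characteristic $p$, and let $m\ge 1$ and $k\ge 0$ be integers. For $b\in\mathbb{F}_q$ let $N_m^*(k,b)$ denote the number of ordered $k$-tuples $(x_1,\dots,x_k)$ of pairwise distinct elements of $\mathbb{F}_q^*$ such that $x_1^m+x_2^m+\cdots+x_k^m=b$. For a real number $t$ put $(t)_k=t(t-1)\cdots(t-k+1)$, with $(t)_0=1$. Then for all $b\in\mathbb{F}_q^*$, $$\left|N_m^*(k,b)-\frac{(q-1)_k}{q}\right|\le\frac{2}{\sqrt q}\left(m\sqrt q+k+\frac{q}{p}\right)_k,$$ and for $b=0$, $$\left|N_m^*(k,0)-\frac{(q-1)_k}{q}\right|\le\left(m\sqrt q+k+\frac{q}{p}\right)_k.$$ -/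

import Mathlib

/-- The number of ordered `k`-tuples of pairwise distinct nonzero elements `x_i` of `F` with
`x_1 ^ m + ⋯ + x_k ^ m = b`. -/
noncomputable def numDistinctDiagonalSolutions (F : Type*) [Field F] (m k : ℕ) (b : F) : ℕ :=
  Nat.card {x : Fin k → Fˣ // Function.Injective x ∧ ∑ i, (x i : F) ^ m = b}

/-- The falling factorial `(t)_k = t (t - 1) ⋯ (t - k + 1)` of a real number `t`. -/
noncomputable def fallingFactorial (t : ℝ) (k : ℕ) : ℝ :=
  (descPochhammer ℝ k).eval t

open Finset

/-! Additive characters detect the equation. Since distinct tuples are orderings of k-subsets, q N =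
(q-1)_k + k! ∑_{c ≠ 0} ψ(-cb) e_k(c), with e_k(c) the elementary symmetric function of the values
ψ(c x^m). As a function of c, e_k is expanded in multiplicative characters and its ℓ¹ norm of
coefficients is tracked; unlike a sup bound, this keeps the cancellation in the sum over c. Newton's
identities reduce e_k to the power sums ∑_x ψ(jc x^m): for p ∤ j at most m characters with Gauss sum
coefficients (norm ≤ m√q), for p ∣ j the constant q-1. The norm of e_k is then at most the t^k
coefficient of (1-t)^(-A), A = m√q + q/p (`charBounded_esymm`). Pairing with ψ(-cb) costs √q if b ≠
0 and q if b = 0. -/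

/-- `f` is a linear combination of multiplicative characters whose coefficients have absolute
values summing to at most `B`. -/
inductive CharBounded {F : Type*} [Field F] : (Fˣ → ℂ) → ℝ → Prop
  | char (χ : MulChar F ℂ) (a : ℂ) : CharBounded (fun c => a * χ c) ‖a‖
  | zero : CharBounded (fun _ => 0) 0
  | add {f g : Fˣ → ℂ} {A B : ℝ} (hf : CharBounded f A) (hg : CharBounded g B) :
      CharBounded (fun c => f c + g c) (A + B)
  | mono {f : Fˣ → ℂ} {A B : ℝ} (hf : CharBounded f A) (h : A ≤ B) : CharBounded f B

/-! ### Calculus of the ℓ¹ norm. -/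

namespace CharBounded

variable {F : Type*} [Field F]

lemma const (a : ℂ) : CharBounded (fun _ : Fˣ => a) ‖a‖ := by
  simpa using CharBounded.char (F := F) 1 a

lemma char_mul (χ : MulChar F ℂ) (a : ℂ) {g : Fˣ → ℂ} {B : ℝ} (hg : CharBounded g B) :
    CharBounded (fun c => a * χ c * g c) (‖a‖ * B) := by
  induction hg with
  | char η b =>
    rw [← norm_mul]
    convert CharBounded.char (χ * η) (a * b) using 2 with c
    simp only [MulChar.mul_apply]
    ring
  | zero => simpa using CharBounded.zero
  | add _ _ h₁ h₂ => simpa only [mul_add] using h₁.add h₂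
  | mono _ h ih => exact ih.mono (by gcongr)

/-- Characters are closed under products, so the ℓ¹ norm is submultiplicative. The sign of `B`
matters when `A` is relaxed. -/
lemma mul {f g : Fˣ → ℂ} {A B : ℝ} (hf : CharBounded f A) (hg : CharBounded g B)
    (hB : 0 ≤ B) : CharBounded (fun c => f c * g c) (A * B) := by
  induction hf with
  | char χ a => exact char_mul χ a hg
  | zero => simpa using CharBounded.zero
  | add _ _ h₁ h₂ => simpa only [add_mul] using h₁.add h₂
  | mono _ h ih => exact ih.mono (by gcongr)

lemma const_mul (a : ℂ) {g : Fˣ → ℂ} {B : ℝ} (hg : CharBounded g B) :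
    CharBounded (fun c => a * g c) (‖a‖ * B) := by
  simpa using char_mul 1 a hg

lemma sum {ι : Type*} (s : Finset ι) {f : ι → Fˣ → ℂ} {B : ι → ℝ}
    (h : ∀ i ∈ s, CharBounded (f i) (B i)) :
    CharBounded (fun c => ∑ i ∈ s, f i c) (∑ i ∈ s, B i) := by
  classical
  induction s using Finset.induction_on with
  | empty => simpa using CharBounded.zero
  | insert a s ha ih =>
    simp only [sum_insert ha]
    exact (h a (mem_insert_self a s)).add (ih fun i hi => h i (mem_insert_of_mem hi))

lemma norm_sum_le [Fintype F] [DecidableEq F] {w : Fˣ → ℂ} {M : ℝ} (hM : 0 ≤ M)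
    (hw : ∀ χ : MulChar F ℂ, ‖∑ c : Fˣ, w c * χ c‖ ≤ M) {f : Fˣ → ℂ} {B : ℝ}
    (hf : CharBounded f B) : ‖∑ c, w c * f c‖ ≤ M * B := by
  induction hf with
  | char χ a =>
    simp only [mul_left_comm _ a, ← mul_sum, norm_mul]
    rw [mul_comm]
    gcongr
    exact hw χ
  | zero => simp
  | add _ _ h₁ h₂ =>
    simp only [mul_add, sum_add_distrib]
    exact (norm_add_le _ _).trans (add_le_add h₁ h₂)
  | mono _ h ih => exact ih.trans (by gcongr)

end CharBounded

/-! ### Gauss sums and orthogonality. -/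

section Characters

variable {F : Type*} [Field F]

lemma mulShift_ne_one {ψ : AddChar F ℂ} (hψ : ψ ≠ 1) {a : F} (ha : a ≠ 0) :
    AddChar.mulShift ψ a ≠ 1 :=
  AddChar.IsPrimitive.of_ne_one hψ ha

variable [Fintype F]

lemma exists_addChar_ne_one : ∃ ψ : AddChar F ℂ, ψ ≠ 1 := by
  obtain ⟨ψ, hψ⟩ := AddChar.exists_apply_ne_zero.mpr (one_ne_zero (α := F))
  exact ⟨ψ, fun h => hψ (by simp [h])⟩

lemma norm_gaussSum_le (χ : MulChar F ℂ) {ψ : AddChar F ℂ} (hψ : ψ ≠ 1) :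
    ‖gaussSum χ ψ‖ ≤ √(Fintype.card F) := by
  by_cases hχ : χ = 1
  · subst hχ
    rw [gaussSum_one_left hψ, norm_neg, norm_one, Real.one_le_sqrt]
    exact_mod_cast Fintype.card_pos
  · have h := gaussSum_mul_gaussSum_eq_card hχ (AddChar.IsPrimitive.of_ne_one hψ)
    rw [← star_gaussSum_eq] at h
    apply Real.le_sqrt_of_sq_le
    have h' := congrArg norm h
    rw [norm_mul, norm_star, Complex.norm_natCast] at h'
    rw [sq, h']

/-- The character group is isomorphic to the cyclic group `Fˣ`. -/
lemma card_mulChar_pow_eq_one_le [Fintype (MulChar F ℂ)] [DecidableEq (MulChar F ℂ)]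
    {m : ℕ} (hm : 0 < m) : #{χ : MulChar F ℂ | χ ^ m = 1} ≤ m := by
  obtain ⟨e⟩ := MulChar.mulEquiv_units F ℂ
  have : IsCyclic (MulChar F ℂ) := isCyclic_of_surjective e.symm e.symm.surjective
  exact IsCyclic.card_pow_eq_one_le hm

variable [DecidableEq F]

lemma sum_units_eq_sum_of_map_zero (f : F → ℂ) (hf : f 0 = 0) : ∑ c : Fˣ, f c = ∑ x, f x := by
  rw [Fintype.sum_eq_add_sum_compl (0 : F) f, hf, zero_add]
  refine sum_bij (fun (c : Fˣ) _ => (c : F)) (by simp) (by simp [Units.ext_iff]) (fun x hx => ?_)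
    (by simp)
  exact ⟨Units.mk0 x (by simpa using hx), by simp, rfl⟩

lemma sum_units_mulChar (χ : MulChar F ℂ) [Decidable (χ = 1)] :
    ∑ c : Fˣ, χ c = if χ = 1 then (Fintype.card Fˣ : ℂ) else 0 := by
  split_ifs with hχ
  · subst hχ
    simp
  · rw [sum_units_eq_sum_of_map_zero χ χ.map_zero, MulChar.sum_eq_zero_of_ne_one hχ]

lemma sum_mulChar_apply [Fintype (MulChar F ℂ)] (u : Fˣ) :
    ∑ χ : MulChar F ℂ, χ u = if u = 1 then (Fintype.card Fˣ : ℂ) else 0 := by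
  split_ifs with hu
  · subst hu
    have := MulChar.card_eq_card_units_of_hasEnoughRootsOfUnity F ℂ
    simp only [Nat.card_eq_fintype_card] at this
    simp [← this]
  · obtain ⟨χ, hχ⟩ := MulChar.exists_apply_ne_one_of_hasEnoughRootsOfUnity F ℂ
      (a := (u : F)) (by simpa using hu)
    -- Multiplication by χ permutes the characters and scales the sum by χ(u) ≠ 1.
    refine eq_zero_of_mul_eq_self_left hχ ?_
    rw [mul_sum]
    exact Fintype.sum_bijective _ (Group.mulLeft_bijective χ) _ _ fun η => by simp

/-- Summation over `m`-th powers through the characters of order dividing `m`. -/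
lemma sum_comp_pow [Fintype (MulChar F ℂ)] [DecidableEq (MulChar F ℂ)] (m : ℕ) (f : Fˣ → ℂ) :
    ∑ x : Fˣ, f (x ^ m) =
      ∑ χ : MulChar F ℂ with χ ^ m = 1, ∑ u : Fˣ, χ u⁻¹ * f u := by
  have hq : (Fintype.card Fˣ : ℂ) ≠ 0 := Nat.cast_ne_zero.mpr Fintype.card_ne_zero
  apply mul_left_cancel₀ hq
  -- Orthogonality detects x^m = u; the inner sum of χ^m over x then vanishes unless χ^m = 1.
  calc (Fintype.card Fˣ : ℂ) * ∑ x : Fˣ, f (x ^ m)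
      = ∑ x : Fˣ, ∑ u : Fˣ, (∑ χ : MulChar F ℂ, χ ((x ^ m * u⁻¹ : Fˣ) : F)) * f u := by
        simp only [sum_mulChar_apply, mul_inv_eq_one, mul_sum, ite_mul, zero_mul, sum_ite_eq,
          mem_univ, if_true]
    _ = ∑ χ : MulChar F ℂ, (∑ x : Fˣ, (χ ^ m) x) * ∑ u : Fˣ, χ u⁻¹ * f u := by
        simp only [sum_mul, mul_sum]
        rw [sum_congr rfl fun _ _ => sum_comm, sum_comm]
        refine sum_congr rfl fun χ _ => ?_
        rw [sum_comm]
        refine sum_congr rfl fun u _ => sum_congr rfl fun x _ => ?_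
        rw [MulChar.pow_apply_coe]
        simp [mul_assoc]
    _ = _ := by
        simp only [sum_units_mulChar, ite_mul, zero_mul, sum_filter, mul_sum, mul_ite, mul_zero]
        refine sum_congr rfl fun χ _ => ?_
        split_ifs <;> simp

lemma norm_sum_units_mul_mulChar_le (χ : MulChar F ℂ) {ψ : AddChar F ℂ} (hψ : ψ ≠ 1) :
    ‖∑ c : Fˣ, ψ c * χ c‖ ≤ √(Fintype.card F) := by
  rw [sum_units_eq_sum_of_map_zero (fun x => ψ x * χ x) (by simp [MulChar.map_zero])]
  simpa only [gaussSum, mul_comm] using norm_gaussSum_le χ hψ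

/-- Monomial sums are `ℓ¹`-bounded combinations of characters of order dividing `m`. -/
lemma charBounded_sum_monomial {ψ : AddChar F ℂ} (hψ : ψ ≠ 1) {m : ℕ} (hm : 0 < m) :
    CharBounded (fun c : Fˣ => ∑ x : Fˣ, ψ (c * (x : F) ^ m))
      (m * √(Fintype.card F)) := by
  classical
  have := Fintype.ofFinite (MulChar F ℂ)
  have key (c : Fˣ) : ∑ x : Fˣ, ψ (c * (x : F) ^ m) =
      ∑ χ : MulChar F ℂ with χ ^ m = 1, (∑ u : Fˣ, ψ u * χ⁻¹ u) * χ c := by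
    have h := sum_comp_pow m fun u : Fˣ => ψ (c * u)
    simp only [Units.val_pow_eq_pow_val] at h
    rw [h]
    refine sum_congr rfl fun χ _ => ?_
    rw [sum_mul]
    -- Substituting v = cu pulls out χ(c) and leaves a Gauss sum as coefficient.
    refine Fintype.sum_bijective _ (Group.mulLeft_bijective c) _ _ fun u => ?_
    have : ((c * u : Fˣ) : F)⁻¹ * c = ((u⁻¹ : Fˣ) : F) := by simp
    rw [MulChar.inv_apply', mul_assoc, ← map_mul, this, Units.val_mul, mul_comm, Units.val_inv_eq_inv_val]
  simp only [key]
  refine (CharBounded.sum _ fun χ _ => CharBounded.char χ _).mono ?_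
  refine (sum_le_card_nsmul _ _ _ fun χ _ => norm_sum_units_mul_mulChar_le _ hψ).trans ?_
  rw [nsmul_eq_mul]
  gcongr
  exact card_mulChar_pow_eq_one_le hm

/-- ψ^j is the shift of ψ by j, trivial exactly when p ∣ j. The term m√q is wasteful in that case,
but makes the bound uniform for the recursion. -/
lemma charBounded_powerSum (p : ℕ) [CharP F p] {ψ : AddChar F ℂ} (hψ : ψ ≠ 1) {m : ℕ}
    (hm : 0 < m) (j : ℕ) :
    CharBounded (fun c : Fˣ => ∑ x : Fˣ, ψ (c * (x : F) ^ m) ^ j)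
      (m * √(Fintype.card F) + if p ∣ j then (Fintype.card F : ℝ) else 0) := by
  have hpow (y : F) : ψ y ^ j = ψ (j * y) := by rw [← AddChar.map_nsmul_eq_pow, nsmul_eq_mul]
  simp only [hpow]
  split_ifs with hj
  · have hj' : (j : F) = 0 := (CharP.cast_eq_zero_iff F p j).mpr hj
    simp only [hj', zero_mul, AddChar.map_zero_eq_one]
    refine (CharBounded.const _).mono ?_
    have h : (Fintype.card Fˣ : ℝ) ≤ Fintype.card F := by
      exact_mod_cast Fintype.card_le_of_injective _ Units.val_injective
    have h' : 0 ≤ (m : ℝ) * √(Fintype.card F) := by positivity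
    simp only [sum_const, card_univ, nsmul_eq_mul, mul_one, Complex.norm_natCast]
    linarith
  · have hj' : (j : F) ≠ 0 := fun h => hj ((CharP.cast_eq_zero_iff F p j).mp h)
    rw [add_zero]
    have := charBounded_sum_monomial (mulShift_ne_one hψ hj') hm
    simpa only [AddChar.mulShift_apply] using this

end Characters

/-! ### Rising factorials and coefficients of (1-t)^(-A). -/

section Pochhammer

lemma ascPochhammer_eval_nonneg {a : ℝ} (ha : 0 ≤ a) (k : ℕ) :
    0 ≤ (ascPochhammer ℝ k).eval a := by
  induction k with
  | zero => simp
  | succ k ih =>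
    rw [ascPochhammer_succ_eval]
    positivity

lemma ascPochhammer_eval_mono {a b : ℝ} (ha : 0 ≤ a) (hab : a ≤ b) (k : ℕ) :
    (ascPochhammer ℝ k).eval a ≤ (ascPochhammer ℝ k).eval b := by
  induction k with
  | zero => simp
  | succ k ih =>
    rw [ascPochhammer_succ_eval, ascPochhammer_succ_eval]
    have h : 0 ≤ (ascPochhammer ℝ k).eval b :=
      ascPochhammer_eval_nonneg (ha.trans hab) k
    gcongr

end Pochhammer

/-- The coefficient of `t ^ k` in `(1 - t) ^ (-A)`. -/
noncomputable def risingBinom (A : ℝ) (k : ℕ) : ℝ :=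
  (ascPochhammer ℝ k).eval A / k.factorial

section RisingBinom

variable {A : ℝ}

lemma risingBinom_succ (k : ℕ) :
    (k + 1 : ℝ) * risingBinom A (k + 1) = (A + k) * risingBinom A k := by
  simp only [risingBinom, ascPochhammer_succ_eval, Nat.factorial_succ, Nat.cast_mul]
  have : (k.factorial : ℝ) ≠ 0 := by positivity
  push_cast
  field_simp

/-- The model recursion with which Newton's identities are compared. -/
lemma mul_risingBinom_eq_sum (k : ℕ) :
    (k : ℝ) * risingBinom A k = A * ∑ n ∈ range k, risingBinom A n := by
  induction k with
  | zero => simp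
  | succ k ih =>
    rw [sum_range_succ, mul_add, ← ih]
    push_cast
    rw [risingBinom_succ]
    ring

lemma risingBinom_nonneg (hA : 0 ≤ A) (k : ℕ) : 0 ≤ risingBinom A k := by
  have : 0 ≤ (ascPochhammer ℝ k).eval A := ascPochhammer_eval_nonneg hA k
  unfold risingBinom
  positivity

/-- Consecutive terms have ratio (A + k)/(k + 1) ≥ 1. -/
lemma monotone_risingBinom (hA : 1 ≤ A) : Monotone (risingBinom A) := by
  refine monotone_nat_of_le_succ fun k => ?_
  have h := risingBinom_succ (A := A) k
  have h' := risingBinom_nonneg (zero_le_one.trans hA) k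
  have hk : (0 : ℝ) < k + 1 := by positivity
  refine le_of_mul_le_mul_left ?_ hk
  rw [h]
  rw [add_comm A]
  gcongr

end RisingBinom

/-- In a sum of a monotone sequence, every `p`-th term carries at most its share. -/
lemma mul_sum_filter_dvd_le {C : ℕ → ℝ} (hC : Monotone C) (h0 : ∀ n, 0 ≤ C n) {p : ℕ}
    (hp : 0 < p) (k : ℕ) :
    (p : ℝ) * ∑ n ∈ range k with p ∣ k - n, C n ≤ ∑ n ∈ range k, C n := by
  induction k using Nat.strong_induction_on with
  | _ k ih =>
    by_cases hk : k < p
    · rw [filter_false_of_mem, sum_empty, mul_zero]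
      · exact sum_nonneg fun n _ => h0 n
      · intro n hn h
        have := Nat.le_of_dvd (by grind) h
        omega
    · obtain ⟨l, rfl⟩ := Nat.exists_eq_add_of_le' (not_lt.mp hk)
      -- In the last block [l, l + p) only n = l qualifies, and p · C l is at most the block's sum.
      have hfil : {n ∈ range (l + p) | p ∣ l + p - n} =
          insert l {n ∈ range l | p ∣ l - n} := by
        ext n
        simp only [mem_filter, mem_range, mem_insert]
        constructor
        · rintro ⟨h1, h2⟩
          by_cases hn : n ≤ l
          · have : l + p - n = (l - n) + p := by omega
            rw [this, Nat.dvd_add_self_right] at h2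
            rcases hn.eq_or_lt with h | h
            · exact Or.inl h
            · exact Or.inr ⟨h, h2⟩
          · have := Nat.le_of_dvd (by omega) h2
            omega
        · rintro (rfl | ⟨h1, h2⟩)
          · exact ⟨by omega, by simp⟩
          · have : l + p - n = (l - n) + p := by omega
            exact ⟨by omega, by rwa [this, Nat.dvd_add_self_right]⟩
      rw [hfil, sum_insert (by simp), sum_range_add, mul_add, add_comm]
      refine add_le_add (ih l (by omega)) ?_
      have := card_nsmul_le_sum (range p) (fun i => C (l + i)) (C l)
        fun i _ => hC (Nat.le_add_right l i)
      simpa using this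

/-! ### Newton's identities and the norm of e_k. -/

lemma mul_esymm_multiset_eq_sum {σ : Type*} [Fintype σ] (f : σ → ℂ) (k : ℕ) :
    (k : ℂ) * (univ.val.map f).esymm k = (-1) ^ (k + 1) *
      ∑ n ∈ range k, (-1) ^ n * (univ.val.map f).esymm n * ∑ x, f x ^ (k - n) := by
  classical
  have h := congrArg (MvPolynomial.aeval f) (MvPolynomial.mul_esymm_eq_sum σ ℂ k)
  simp only [map_mul, map_natCast, map_pow, map_neg, map_one, map_sum,
    MvPolynomial.aeval_esymm_eq_multiset_esymm, MvPolynomial.psum, MvPolynomial.aeval_X] at h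
  rw [h, sum_filter, Nat.sum_antidiagonal_eq_sum_range_succ_mk, sum_range_succ]
  congr 1
  simp only [lt_irrefl, if_false, add_zero]
  exact sum_congr rfl fun n hn => if_pos (mem_range.mp hn)

lemma charBounded_esymm {F : Type*} [Field F] [Fintype F] [DecidableEq F] (p : ℕ) [CharP F p]
    {ψ : AddChar F ℂ} (hψ : ψ ≠ 1) {m : ℕ} (hm : 0 < m) (k : ℕ) :
    CharBounded (fun c : Fˣ => (univ.val.map fun x : Fˣ => ψ (c * (x : F) ^ m)).esymm k)
      (risingBinom (m * √(Fintype.card F) + Fintype.card F / p) k) := by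
  set D : ℝ := m * √(Fintype.card F) with hD
  set q : ℝ := (Fintype.card F : ℝ) with hq
  set A : ℝ := D + q / p with hA
  have hp : 0 < p := (CharP.char_is_prime F p).pos
  have hp' : (0 : ℝ) < p := by exact_mod_cast hp
  have hD1 : 1 ≤ D := by
    have h1 : (1 : ℝ) ≤ m := by exact_mod_cast hm
    have h2 : (1 : ℝ) ≤ √q := by
      rw [Real.one_le_sqrt, hq]
      exact_mod_cast Fintype.card_pos
    exact one_le_mul_of_one_le_of_one_le h1 h2
  have hA1 : 1 ≤ A := by
    have : 0 ≤ q / p := by positivity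
    linarith
  have hC0 := risingBinom_nonneg (zero_le_one.trans hA1)
  induction k using Nat.strong_induction_on with
  | _ k ih =>
    rcases Nat.eq_zero_or_pos k with rfl | hk
    · simpa [risingBinom, Multiset.esymm] using CharBounded.const (F := F) 1
    have hk' : (0 : ℝ) < k := by exact_mod_cast hk
    have hsum : CharBounded (fun c : Fˣ => ∑ n ∈ range k, (-1) ^ n *
        ((univ.val.map fun x : Fˣ => ψ (c * (x : F) ^ m)).esymm n *
          ∑ x : Fˣ, ψ (c * (x : F) ^ m) ^ (k - n)))
        (∑ n ∈ range k, risingBinom A n * (D + if p ∣ k - n then q else 0)) := by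
      refine CharBounded.sum _ fun n hn => ?_
      have := ((ih n (mem_range.mp hn)).mul (charBounded_powerSum p hψ hm (k - n))
        (by positivity)).const_mul ((-1) ^ n)
      simpa using this
    have hle : ∑ n ∈ range k, risingBinom A n * (D + if p ∣ k - n then q else 0) ≤
        k * risingBinom A k := by
      -- At most 1/p of the sum of the coefficients lies on p ∣ k - n, so the extra q there costs
      -- only q/p: hence A = D + q/p.
      have h := mul_sum_filter_dvd_le (monotone_risingBinom hA1) hC0 hp k
      rw [sum_filter] at h
      simp only [mul_add, mul_ite, mul_zero, sum_add_distrib]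
      rw [mul_risingBinom_eq_sum, hA, add_mul, ← sum_mul, mul_comm D]
      gcongr
      rw [div_mul_eq_mul_div, le_div_iff₀ hp']
      calc _ = q * (p * ∑ n ∈ range k, if p ∣ k - n then risingBinom A n else 0) := by
            simp only [mul_sum, sum_mul]
            refine sum_congr rfl fun n _ => ?_
            split_ifs <;> ring
        _ ≤ _ := by gcongr
    have hfin := (hsum.mono hle).const_mul ((k : ℂ)⁻¹ * (-1) ^ (k + 1))
    convert hfin using 1
    · funext c
      have := mul_esymm_multiset_eq_sum (fun x : Fˣ => ψ (c * (x : F) ^ m)) k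
      have hkC : (k : ℂ) ≠ 0 := by exact_mod_cast hk.ne'
      simp only [mul_assoc] at this ⊢
      rw [← this, inv_mul_cancel_left₀ hkC]
    · simp
      field_simp

/-! ### Counting solutions. -/

lemma sum_embedding_prod_eq_factorial_mul_esymm {σ : Type*} [Fintype σ] [DecidableEq σ]
    (f : σ → ℂ) (k : ℕ) :
    ∑ x : Fin k ↪ σ, ∏ i, f (x i) = k.factorial * (univ.val.map f).esymm k := by
  rw [esymm_map_val, mul_sum]
  have hmaps : ∀ x ∈ (univ : Finset (Fin k ↪ σ)), univ.map x ∈ powersetCard k (univ : Finset σ) :=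
    fun x _ => by simp [mem_powersetCard]
  rw [← sum_fiberwise_of_maps_to hmaps]
  refine sum_congr rfl fun s hs => ?_
  have hs' : #s = k := (mem_powersetCard.mp hs).2
  -- Each k-subset is the image of exactly its k! orderings.
  have hcard : #{x : Fin k ↪ σ | univ.map x = s} = k.factorial := by
    have h : Fintype.card (Fin k ↪ s) = k.factorial := by
      simp [Fintype.card_embedding_eq, hs', Nat.descFactorial_self]
    rw [← h, ← card_univ]
    symm
    refine card_bij (fun y _ => y.trans (Function.Embedding.subtype _)) ?_ ?_ ?_
    · intro y _
      simp only [mem_filter, mem_univ, true_and]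
      refine eq_of_subset_of_card_le (fun a ha => ?_) (by simp [hs'])
      obtain ⟨i, -, rfl⟩ := mem_map.mp ha
      exact (y i).2
    · intro y _ z _ h
      ext i
      exact DFunLike.congr_fun h i
    · intro x hx
      have hx' : univ.map x = s := (mem_filter.mp hx).2
      have hmem (i) : x i ∈ s := hx' ▸ mem_map_of_mem x (mem_univ i)
      exact ⟨⟨fun i => ⟨x i, hmem i⟩, fun i j h => x.injective (congrArg Subtype.val h)⟩,
        mem_univ _, rfl⟩
  rw [← hcard, ← nsmul_eq_mul, ← sum_const]
  refine sum_congr rfl fun x hx => ?_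
  rw [← (mem_filter.mp hx).2, prod_map]

/-- The character sum formula for the number of solutions. -/
lemma card_mul_numDistinctDiagonalSolutions {F : Type*} [Field F] [Fintype F] [DecidableEq F]
    {ψ : AddChar F ℂ} (hψ : ψ ≠ 1) (m k : ℕ) (b : F) :
    (Fintype.card F : ℂ) * numDistinctDiagonalSolutions F m k b =
      (Fintype.card Fˣ).descFactorial k + k.factorial * ∑ c : Fˣ, ψ (c * -b) *
        (univ.val.map fun x : Fˣ => ψ (c * (x : F) ^ m)).esymm k := by
  have hN : numDistinctDiagonalSolutions F m k b =
      #{x : Fin k ↪ Fˣ | ∑ i, (x i : F) ^ m = b} := by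
    rw [numDistinctDiagonalSolutions, ← Fintype.card_subtype, ← Nat.card_eq_fintype_card]
    exact Nat.card_congr
      { toFun := fun x => ⟨⟨x.1, x.2.1⟩, x.2.2⟩
        invFun := fun x => ⟨x.1, x.1.injective, x.2⟩
        left_inv := fun _ => rfl
        right_inv := fun _ => rfl }
  have horth (y : F) : ∑ c : F, ψ (c * (y - b)) = if y = b then (Fintype.card F : ℂ) else 0 := by
    rw [AddChar.sum_mulShift _ (AddChar.IsPrimitive.of_ne_one hψ)]
    simp [sub_eq_zero]
  have hsplit (f : F → ℂ) : ∑ c, f c = f 0 + ∑ c : Fˣ, f c := by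
    have h := sum_units_eq_sum_of_map_zero (fun c => if c = 0 then 0 else f c) (by simp)
    simp only [Units.ne_zero, if_false] at h
    rw [h, Fintype.sum_eq_add_sum_compl 0, Fintype.sum_eq_add_sum_compl 0, if_pos rfl, zero_add]
    congr 1
    refine sum_congr rfl fun c hc => (if_neg ?_).symm
    simpa using hc
  calc (Fintype.card F : ℂ) * numDistinctDiagonalSolutions F m k b
      = ∑ x : Fin k ↪ Fˣ, ∑ c : F, ψ (c * (∑ i, (x i : F) ^ m - b)) := by
        simp only [horth, hN, card_filter, Nat.cast_sum, mul_sum]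
        exact sum_congr rfl fun x _ => by split_ifs <;> simp
    _ = ∑ x : Fin k ↪ Fˣ, (1 + ∑ c : Fˣ, ψ (c * -b) * ∏ i, ψ (c * (x i : F) ^ m)) := by
        refine sum_congr rfl fun x _ => ?_
        -- The frequency c = 0 contributes 1 per tuple, giving the main term.
        rw [hsplit]
        congr 1
        · simp
        · refine sum_congr rfl fun c _ => ?_
          rw [sub_eq_neg_add, mul_add, AddChar.map_add_eq_mul, mul_sum]
          exact congrArg (_ * ·) (map_prod ψ.toMonoidHom
            (fun i => Multiplicative.ofAdd ((c : F) * (x i : F) ^ m)) univ)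
    _ = _ := by
        rw [sum_add_distrib, sum_comm, mul_sum]
        congr 1
        · simp [Fintype.card_embedding_eq]
        · refine sum_congr rfl fun c _ => ?_
          rw [← mul_sum, sum_embedding_prod_eq_factorial_mul_esymm (fun x : Fˣ => ψ (c * (x : F) ^ m))]
          ring

/-- The deviation from the expected count, given a bound for the twisted character sums. -/
lemma abs_numDistinctDiagonalSolutions_sub_le {F : Type*} [Field F] [Fintype F] [DecidableEq F]
    (p : ℕ) [CharP F p] {ψ : AddChar F ℂ} (hψ : ψ ≠ 1) {m : ℕ} (hm : 0 < m) (k : ℕ) (b : F)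
    {M : ℝ} (hM : 0 ≤ M) (hb : ∀ χ : MulChar F ℂ, ‖∑ c : Fˣ, ψ (c * -b) * χ c‖ ≤ M) :
    |(numDistinctDiagonalSolutions F m k b : ℝ)
        - fallingFactorial ((Fintype.card F : ℝ) - 1) k / (Fintype.card F : ℝ)| ≤
      M / Fintype.card F * fallingFactorial ((m : ℝ) * √(Fintype.card F : ℝ) + (k : ℝ)
            + (Fintype.card F : ℝ) / (p : ℝ)) k := by
  set A : ℝ := m * √(Fintype.card F) + Fintype.card F / p with hA
  have hA0 : 0 ≤ A := by positivity
  have hq : (0 : ℝ) < Fintype.card F := by exact_mod_cast Fintype.card_pos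
  have hfac : (0 : ℝ) < k.factorial := by positivity
  have hcard : (Fintype.card F : ℝ) - 1 = (Fintype.card Fˣ : ℕ) := by
    rw [Fintype.card_units, Nat.cast_sub Fintype.card_pos, Nat.cast_one]
  have hfall : fallingFactorial ((Fintype.card F : ℝ) - 1) k =
      ((Fintype.card Fˣ).descFactorial k : ℕ) := by
    rw [hcard, fallingFactorial, descPochhammer_eval_eq_descFactorial]
  have hmain := CharBounded.norm_sum_le hM hb (charBounded_esymm p hψ hm k)
  have hrise : k.factorial * risingBinom A k ≤ fallingFactorial (m * √(Fintype.card F : ℝ) + k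
      + (Fintype.card F : ℝ) / p) k := by
    rw [risingBinom, mul_div_cancel₀ _ hfac.ne', fallingFactorial,
      descPochhammer_eval_eq_ascPochhammer]
    -- The left side is A(A+1)⋯(A+k-1), while (A+k)_k is the rising factorial from A + 1.
    exact ascPochhammer_eval_mono hA0 (by rw [hA]; linarith) k
  have hformula := card_mul_numDistinctDiagonalSolutions hψ m k b
  set S : ℂ := ∑ c : Fˣ, ψ (c * -b) *
    (univ.val.map fun x : Fˣ => ψ (c * (x : F) ^ m)).esymm k with hS
  set N : ℝ := (numDistinctDiagonalSolutions F m k b : ℝ) with hN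
  have hdiff : (Fintype.card F : ℝ) *
      |N - fallingFactorial ((Fintype.card F : ℝ) - 1) k / Fintype.card F| =
      k.factorial * ‖S‖ := by
    rw [← abs_of_pos hq, ← abs_mul, abs_of_pos hq, mul_sub, mul_div_cancel₀ _ hq.ne', hfall,
      ← Real.norm_eq_abs, ← Complex.norm_real, hN]
    push_cast
    rw [hformula, add_sub_cancel_left, norm_mul, Complex.norm_natCast]
  rw [div_mul_eq_mul_div, le_div_iff₀ hq, mul_comm, hdiff]
  calc k.factorial * ‖S‖ ≤ k.factorial * (M * risingBinom A k) := by gcongr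
    _ = M * (k.factorial * risingBinom A k) := by ring
    _ ≤ _ := by gcongr

theorem mainTheorem2 (F : Type*) [Field F] [Fintype F] (p : ℕ) [CharP F p]
    (m : ℕ) (hm : 0 < m) (k : ℕ) :
    (∀ b : F, b ≠ 0 →
      |(numDistinctDiagonalSolutions F m k b : ℝ)
          - fallingFactorial ((Fintype.card F : ℝ) - 1) k / (Fintype.card F : ℝ)|
        ≤ 2 / Real.sqrt (Fintype.card F : ℝ) *
          fallingFactorial ((m : ℝ) * Real.sqrt (Fintype.card F : ℝ) + (k : ℝ)
            + (Fintype.card F : ℝ) / (p : ℝ)) k) ∧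
    |(numDistinctDiagonalSolutions F m k (0 : F) : ℝ)
        - fallingFactorial ((Fintype.card F : ℝ) - 1) k / (Fintype.card F : ℝ)|
      ≤ fallingFactorial ((m : ℝ) * Real.sqrt (Fintype.card F : ℝ) + (k : ℝ)
          + (Fintype.card F : ℝ) / (p : ℝ)) k := by
  classical
  obtain ⟨ψ, hψ⟩ := exists_addChar_ne_one (F := F)
  have hq : (0 : ℝ) < Fintype.card F := by exact_mod_cast Fintype.card_pos
  refine ⟨fun b hb => ?_, ?_⟩
  · have h := abs_numDistinctDiagonalSolutions_sub_le p hψ hm k b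
      (Real.sqrt_nonneg (Fintype.card F)) fun χ => by
        have := norm_sum_units_mul_mulChar_le χ (mulShift_ne_one hψ (neg_ne_zero.mpr hb))
        simpa only [AddChar.mulShift_apply, mul_comm (-b)] using this
    -- With M = √q the factor M/q is 1/√q, half of what is claimed; nonnegativity of the bound
    -- permits doubling.
    rw [Real.sqrt_div_self'] at h
    have hnonneg := (abs_nonneg _).trans h
    rw [show 2 / √(Fintype.card F : ℝ) = 2 * (1 / √(Fintype.card F : ℝ)) by ring, mul_assoc]
    linarith
  · have h := abs_numDistinctDiagonalSolutions_sub_le p hψ hm k (0 : F) hq.le fun χ => by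
      have hle : (Fintype.card Fˣ : ℝ) ≤ Fintype.card F := by
        exact_mod_cast Fintype.card_le_of_injective _ Units.val_injective
      -- For b = 0 the additive twist disappears and the trivial character gives q - 1, so M = q and
      -- M/q = 1.
      simp only [neg_zero, mul_zero, AddChar.map_zero_eq_one, one_mul, sum_units_mulChar]
      split_ifs <;> simp [hle]
    rwa [div_self hq.ne', one_mul] at h
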